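/- Let $G$ be a finite, simple, connected, triangle-free graph of order $n$ and minimum degree $\delta\ge 1$ (equivalently, $n\ge 2$), and let $k\ge 1$ be an integer. Then $G$ has a spanning tree $T$ with $$SW_k(T) \le \frac{k-1}{k+1}\,\frac{2(n+1)}{\delta}\binom{n}{k} + \Big(\frac{4\delta-2}{\delta}+3k+1\Big)\binom{n}{k}.$$ Here the Steiner distance $d_T(S)$ of a set $S$ of vertices of $T$ is the minimum number of edges of a connected subgraph of $T$ containing $S$, and the Steiner $k$-Wiener index is $SW_k(T)=\sum_{S\subseteq V(T),\,|S|=k} d_T(S)$. -/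

import Mathlib

namespace SimpleGraph

/-- The Steiner distance `d_G(S)` of a set `S` of vertices of a (finite, connected) graph `G`:
the minimum size (number of edges) of a connected subgraph of `G` containing all vertices of `S`. -/
noncomputable def steinerDist {V : Type*} (G : SimpleGraph V) (S : Set V) : ℕ :=
  sInf {m : ℕ | ∃ H : G.Subgraph, H.Connected ∧ S ⊆ H.verts ∧ H.edgeSet.ncard = m}

/-- The Steiner `k`-Wiener index `SW_k(G)`: the sum of the Steiner distances of all
`k`-element sets of vertices of `G`. -/
noncomputable def steinerWiener {V : Type*} [Fintype V] (G : SimpleGraph V) (k : ℕ) : ℕ :=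
  ∑ S ∈ (Finset.univ : Finset V).powersetCard k, G.steinerDist (S : Set V)

/-- `T` is a spanning tree of `G`: a tree on all vertices of `G` whose edges are edges of `G`. -/
def IsSpanningTree {V : Type*} (T G : SimpleGraph V) : Prop :=
  T ≤ G ∧ T.IsTree

end SimpleGraph

/-!
The spanning tree is built around edges `y i z i`, for `i < m`, whose neighbourhoods (the sets of
vertices adjacent to an end of the edge) are pairwise disjoint. They are chosen greedily, each new
edge joined by a path `a i, b i, y i` to the neighbourhood of an earlier edge, the one with index
`p i`. In a maximal such family every vertex has distance at most two from some neighbourhood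
(`SimpleGraph.exists_linkedEdges_lev`), so a spanning tree `T` that contains the edges, their
neighbourhoods and the linking paths can be completed by shortest paths to the neighbourhoods
(`SimpleGraph.LinkedEdges.exists_isTree`). Every vertex `v` is assigned to an edge `f v` at
distance at most three in `T`. As `G` has no triangles, each neighbourhood has at least `2 * δ`
vertices, so each edge is assigned at least `2 * δ` vertices.

The parent function `p` makes the indices a tree. A connected subgraph of `T` that contains a
`k`-set `S` is obtained from paths of length at most three from the vertices of `S` to their edges,
from four edges of `T` (the linking path and `y i z i`) for each edge of the index tree that splits
`f '' S`, and from one more edge `y i z i` at the top (`ParentFun.spannedBy_biUnion`). Hence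
`d_T(S) ≤ 3 * k + 1 + 4 * t(S)`, where `t(S)` counts the edges of the index tree that split `S`.

An edge of the index tree that cuts off `s` vertices splits
`splitCount n k s = n.choose k - s.choose k - (n - s).choose k` of the `k`-sets. This is a sum of
nonnegative steps over the thresholds `x ≤ min s (n - s)`, so an upper bound for the number of
index edges with at least `x` vertices on both sides suffices. That number is at most
`(n - 2 * x) / (2 * δ) + 1`, since contracting all other index edges leaves a tree that has two
leaves of weight at least `x` (`ParentFun.two_mul_add_card_mul_le`). The summation of the resulting
bounds is exact up to the term `splitCount n k (n / 2) ≤ n.choose k`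
(`sum_splitStep_mul`, `sum_splitCount_le`).
-/

/-! ### Connected subgraphs with few edges -/

namespace SimpleGraph

/-- `T.SpannedBy B m`: the set `B` lies in a connected subgraph of `T` with at most `m` edges. -/
def SpannedBy {V : Type*} (T : SimpleGraph V) (B : Set V) (m : ℕ) : Prop :=
  ∃ H : T.Subgraph, H.Connected ∧ B ⊆ H.verts ∧ H.edgeSet.ncard ≤ m

section SpannedBy

variable {V : Type*} {T : SimpleGraph V} {B C : Set V} {l m : ℕ}

theorem SpannedBy.steinerDist_le (h : T.SpannedBy B m) : T.steinerDist B ≤ m := by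
  obtain ⟨H, hH, hB, hm⟩ := h
  refine le_trans ?_ hm
  apply Nat.sInf_le
  exact ⟨H, hH, hB, rfl⟩

theorem SpannedBy.mono (h : T.SpannedBy C l) (hBC : B ⊆ C) (hlm : l ≤ m) : T.SpannedBy B m := by
  obtain ⟨H, hH, hB, hm⟩ := h
  exact ⟨H, hH, hBC.trans hB, hm.trans hlm⟩

theorem spannedBy_singleton (v : V) : T.SpannedBy {v} 0 :=
  ⟨T.singletonSubgraph v, Subgraph.singletonSubgraph_connected, by simp, by simp⟩

theorem Adj.spannedBy {u v : V} (h : T.Adj u v) : T.SpannedBy {u, v} 1 :=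
  ⟨T.subgraphOfAdj h, Subgraph.subgraphOfAdj_connected h, by simp, by simp⟩

theorem SpannedBy.union [Finite V] (hB : T.SpannedBy B l) (hC : T.SpannedBy C m)
    (hBC : (B ∩ C).Nonempty) : T.SpannedBy (B ∪ C) (l + m) := by
  obtain ⟨H, hH, hBH, hl⟩ := hB
  obtain ⟨K, hK, hCK, hm⟩ := hC
  refine ⟨H ⊔ K, Subgraph.connected_sup hH.preconnected hK.preconnected ?_, ?_, ?_⟩
  · exact hBC.mono (Set.inter_subset_inter hBH hCK)
  · exact Set.union_subset_union hBH hCK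
  · rw [Subgraph.edgeSet_sup]
    exact (Set.ncard_union_le _ _).trans (add_le_add hl hm)

/-- Appending an edge (or repeating a vertex) at a vertex that is already covered. -/
theorem SpannedBy.insert [Finite V] {u v : V} (hB : T.SpannedBy B m) (hu : u ∈ B)
    (h : v = u ∨ T.Adj v u) : T.SpannedBy (insert v B) (m + 1) := by
  rcases h with rfl | h
  · exact hB.mono (by simp [hu]) (Nat.le_succ m)
  · exact (hB.union h.spannedBy ⟨u, hu, by simp⟩).mono
      (by rintro x (rfl | hx) <;> simp_all) le_rfl

/-- If each vertex of `S` can be joined to a vertex of `B` at cost `l`, then `S` can be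
spanned at a cost of `l` per vertex on top of the cost of `B`. -/
theorem SpannedBy.of_forall_exists [Finite V] (hB : T.SpannedBy B m) (S : Finset V)
    (h : ∀ v ∈ S, ∃ c ∈ B, T.SpannedBy {v, c} l) : T.SpannedBy (S : Set V) (l * S.card + m) := by
  classical
  suffices T.SpannedBy (S ∪ B : Set V) (l * S.card + m) from
    this.mono Set.subset_union_left le_rfl
  induction S using Finset.induction_on with
  | empty => simpa using hB
  | insert v S hv ih =>
    obtain ⟨c, hc, hvc⟩ := h v (by simp)
    refine (hvc.union (ih fun w hw => h w (by simp [hw])) ⟨c, by simp, Or.inr hc⟩).mono ?_ ?_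
    · intro x
      simp only [Finset.coe_insert, Set.mem_union, Set.mem_insert_iff, Set.mem_singleton_iff]
      tauto
    · rw [Finset.card_insert_of_notMem hv, mul_add, mul_one]
      omega

end SpannedBy

end SimpleGraph

/-! ### Rooted trees on an initial segment of the natural numbers

A rooted tree on the indices `0, …, m - 1` with root `0` is encoded by its parent function
`p : ℕ → ℕ`, which satisfies `p 0 = 0` and `p i < i` for `0 < i`. -/

namespace ParentFun

/-- `Anc p i j`: in the tree with parent function `p`, the index `i` is an ancestor of `j`
(every index is an ancestor of itself). -/
def Anc (p : ℕ → ℕ) (i j : ℕ) : Prop := ∃ r, p^[r] j = i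

/-- Removing the edge from `i` to its parent separates two indices of `Q`. -/
def Splits (p : ℕ → ℕ) (i : ℕ) (Q : Finset ℕ) : Prop :=
  (∃ j ∈ Q, Anc p i j) ∧ ∃ j ∈ Q, ¬ Anc p i j

variable {p : ℕ → ℕ}

theorem Anc.refl (i : ℕ) : Anc p i i := ⟨0, rfl⟩

theorem Anc.trans {i j l : ℕ} (h : Anc p i j) (h' : Anc p j l) : Anc p i l := by
  obtain ⟨r, rfl⟩ := h
  obtain ⟨s, rfl⟩ := h'
  exact ⟨r + s, Function.iterate_add_apply _ _ _ _⟩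

theorem Anc.le (hp : ∀ i, p i ≤ i) {i j : ℕ} (h : Anc p i j) : i ≤ j := by
  obtain ⟨r, rfl⟩ := h
  induction r with
  | zero => rfl
  | succ r ih =>
    rw [Function.iterate_succ_apply']
    exact (hp _).trans ih

theorem anc_total {i j l : ℕ} (hi : Anc p i l) (hj : Anc p j l) : Anc p i j ∨ Anc p j i := by
  obtain ⟨r, rfl⟩ := hi
  obtain ⟨s, rfl⟩ := hj
  rcases le_total r s with h | h
  · exact Or.inr ⟨s - r, by rw [← Function.iterate_add_apply, Nat.sub_add_cancel h]⟩
  · exact Or.inl ⟨r - s, by rw [← Function.iterate_add_apply, Nat.sub_add_cancel h]⟩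

theorem anc_parent_iff {i j : ℕ} (h : i ≠ j) : Anc p i (p j) ↔ Anc p i j := by
  constructor
  · exact fun h' => h'.trans ⟨1, rfl⟩
  · rintro ⟨_ | r, hr⟩
    · exact absurd hr.symm h
    · exact ⟨r, hr⟩

/-- If the block of each index `i` can be spanned with one edge, and with four edges together
with a vertex of the block of the parent of `i`, then the blocks of the indices in `Q` can be
spanned at a cost of four edges for every edge of the index tree that splits `Q`, plus one. -/
theorem spannedBy_biUnion {V : Type*} [Finite V] {T : SimpleGraph V} {m : ℕ}
    (hp0 : p 0 = 0) (hp : ∀ i, 0 < i → p i < i) (E : ℕ → Set V)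
    (hE : ∀ i < m, T.SpannedBy (E i) 1)
    (hlink : ∀ i < m, 0 < i → ∃ c ∈ E (p i), T.SpannedBy (insert c (E i)) 4)
    (Q : Finset ℕ) (hQ : Q.Nonempty) (hQm : ∀ i ∈ Q, i < m) (R : Finset ℕ)
    (hR : ∀ i ∈ Finset.Ico 1 m, Splits p i Q → i ∈ R) :
    T.SpannedBy (⋃ i ∈ Q, E i) (4 * R.card + 1) := by
  classical
  -- The largest index of `Q` is replaced by its parent, which decreases `∑ i ∈ Q, i`.
  induction hs : ∑ i ∈ Q, i using Nat.strong_induction_on generalizing Q R with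
  | _ s ih =>
  subst hs
  set i := Q.max' hQ with hi
  have hiQ : i ∈ Q := Q.max'_mem hQ
  by_cases hne : (Q.erase i).Nonempty
  · obtain ⟨j, hj⟩ := hne
    have hlt : ∀ l ∈ Q.erase i, l < i := fun l hl =>
      lt_of_le_of_ne (Q.le_max' l (Finset.mem_of_mem_erase hl)) (Finset.ne_of_mem_erase hl)
    have hi0 : 0 < i := (Nat.zero_le j).trans_lt (hlt j hj)
    have hpi := hp i hi0
    have hle : ∀ l, p l ≤ l := fun l => by
      rcases Nat.eq_zero_or_pos l with rfl | hl
      · exact hp0.le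
      · exact (hp l hl).le
    have him := hQm i hiQ
    have hiR : i ∈ R := hR i (Finset.mem_Ico.2 ⟨hi0, him⟩)
      ⟨⟨i, hiQ, Anc.refl i⟩, j, Finset.mem_of_mem_erase hj, fun h => (hlt j hj).not_ge (h.le hle)⟩
    have hsum : ∑ l ∈ insert (p i) (Q.erase i), l < ∑ l ∈ Q, l := by
      rw [← Finset.add_sum_erase Q (fun l => l) hiQ]
      by_cases h : p i ∈ Q.erase i
      · rw [Finset.insert_eq_of_mem h]; omega
      · rw [Finset.sum_insert h]; omega
    have hlt' : ∀ l ∈ insert (p i) (Q.erase i), l < i := fun l hl => by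
      rcases Finset.mem_insert.1 hl with rfl | hl
      exacts [hpi, hlt l hl]
    have key := ih _ hsum (insert (p i) (Q.erase i)) (Finset.insert_nonempty _ _)
      (fun l hl => (hlt' l hl).trans him) (R.erase i) (fun l hl hsp => by
        obtain ⟨⟨u, hu, hlu⟩, v, hv, hlv⟩ := hsp
        have hli : l ≠ i := by
          rintro rfl
          exact (hlt' u hu).not_ge (hlu.le hle)
        refine Finset.mem_erase.2 ⟨hli, hR l hl ⟨?_, ?_⟩⟩
        · rcases Finset.mem_insert.1 hu with rfl | hu
          · exact ⟨i, hiQ, (anc_parent_iff hli).1 hlu⟩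
          · exact ⟨u, Finset.mem_of_mem_erase hu, hlu⟩
        · rcases Finset.mem_insert.1 hv with rfl | hv
          · exact ⟨i, hiQ, fun h => hlv ((anc_parent_iff hli).2 h)⟩
          · exact ⟨v, Finset.mem_of_mem_erase hv, hlv⟩) rfl
    obtain ⟨c, hc, hci⟩ := hlink i him hi0
    refine (key.union hci ⟨c, Set.mem_biUnion (Finset.mem_insert_self _ _) hc,
      Set.mem_insert _ _⟩).mono ?_ ?_
    · refine Set.iUnion₂_subset fun l hl => ?_
      by_cases hli : l = i
      · subst hli
        exact (Set.subset_insert _ _).trans Set.subset_union_right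
      · refine Set.Subset.trans ?_ Set.subset_union_left
        exact Set.subset_biUnion_of_mem (u := E)
          (Finset.mem_insert_of_mem (Finset.mem_erase.2 ⟨hli, hl⟩))
    · have := Finset.card_erase_add_one hiR
      omega
  · have : Q = {i} := by
      rw [Finset.not_nonempty_iff_eq_empty] at hne
      rw [← Finset.insert_erase hiQ, hne]; simp
    rw [this]
    simpa using (hE i (hQm i hiQ)).mono subset_rfl (by omega)

end ParentFun

namespace ParentFun

open Finset

variable {p : ℕ → ℕ}

open Classical in
/-- The total weight of the indices below `m` that descend from `i`. -/
noncomputable def subtreeWeight (p : ℕ → ℕ) (m : ℕ) (w : ℕ → ℕ) (i : ℕ) : ℕ :=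
  ∑ j ∈ (range m).filter (Anc p i), w j

/-- In a tree all of whose indices have weight at least `D`, let `C` be a set of edges each of
which cuts off weight at least `x` on both sides. Contracting the other edges leaves a tree
with `C.card + 1` vertices, each of weight at least `D`, and two of them, leaves, of weight at
least `x`. -/
theorem two_mul_add_card_mul_le (hp : ∀ i, p i ≤ i) {m x D : ℕ} {w : ℕ → ℕ}
    (hw : ∀ i < m, D ≤ w i) {C : Finset ℕ} (hC : C ⊆ Ico 1 m) (hne : C.Nonempty)
    (hx : ∀ i ∈ C, x ≤ subtreeWeight p m w i ∧ subtreeWeight p m w i + x ≤ ∑ j ∈ range m, w j) :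
    2 * x + C.card * D ≤ ∑ j ∈ range m, w j + D := by
  classical
  set sub : ℕ → Finset ℕ := fun i => (range m).filter (Anc p i) with hsub
  have hCm : ∀ i ∈ C, i ∈ range m := fun i hi => mem_range.2 (mem_Ico.1 (hC hi)).2
  have hcard : ∀ B ⊆ range m, B.card * D ≤ ∑ j ∈ B, w j := fun B hB => by
    rw [← smul_eq_mul]
    exact card_nsmul_le_sum B w D fun j hj => hw j (mem_range.1 (hB hj))
  -- The subtree below the largest index of `C` is one of the two leaves.
  set i := C.max' hne with hi
  have hiC : i ∈ C := C.max'_mem hne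
  have hdesc : ∀ j ∈ C, Anc p i j → j = i := fun j hj h => le_antisymm (C.le_max' j hj) (h.le hp)
  by_cases hchain : ∀ j ∈ C, Anc p j i
  · -- The edges of `C` lie on one path from the root: the other leaf is the root side of the
    -- edge with the smallest index.
    set t := C.min' hne with ht
    have htC : t ∈ C := C.min'_mem hne
    have htop : ∀ j ∈ C, Anc p t j := fun j hj => by
      rcases anc_total (hchain t htC) (hchain j hj) with h | h
      · exact h
      · exact le_antisymm (h.le hp) (C.min'_le j hj) ▸ Anc.refl j
    have hsubset : sub i ∪ C.erase i ⊆ sub t := by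
      refine union_subset (fun j hj => ?_) (fun j hj => ?_)
      · have := mem_filter.1 hj
        exact mem_filter.2 ⟨this.1, (htop i hiC).trans this.2⟩
      · have hjC := mem_of_mem_erase hj
        exact mem_filter.2 ⟨hCm j hjC, htop j hjC⟩
    have hdisj : Disjoint (sub i) (C.erase i) := by
      refine disjoint_left.2 fun j hj hj' => ne_of_mem_erase hj' ?_
      exact hdesc j (mem_of_mem_erase hj') (mem_filter.1 hj).2
    have h1 := sum_le_sum_of_subset (f := w) hsubset
    rw [sum_union hdisj] at h1
    have h2 := hcard (C.erase i) ((erase_subset _ _).trans hCm)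
    have h3 := (hx i hiC).1
    have h4 := (hx t htC).2
    have h5 : C.card = (C.erase i).card + 1 := (card_erase_add_one hiC).symm
    rw [h5, add_mul, one_mul]
    change x ≤ ∑ j ∈ sub i, w j at h3
    change ∑ j ∈ sub t, w j + x ≤ _ at h4
    omega
  · -- Otherwise the other leaf is the subtree below the largest index that is not an ancestor
    -- of `i`.
    push Not at hchain
    obtain ⟨j₀, hj₀, hj₀'⟩ := hchain
    have hne' : (C.filter fun j => ¬ Anc p j i).Nonempty := ⟨j₀, mem_filter.2 ⟨hj₀, hj₀'⟩⟩
    set t := (C.filter fun j => ¬ Anc p j i).max' hne' with ht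
    obtain ⟨htC, hti⟩ := mem_filter.1 (max'_mem _ hne')
    rw [← ht] at htC hti
    have hit : i ≠ t := by
      rintro h
      exact hti (h ▸ Anc.refl _)
    have hdesc' : ∀ j ∈ C, Anc p t j → j = t := fun j hj h => by
      refine le_antisymm ?_ (h.le hp)
      exact le_max' _ _ (mem_filter.2 ⟨hj, fun h' => hti (h.trans h')⟩)
    set R := insert 0 ((C.erase i).erase t) with hR
    have hpos : ∀ j ∈ C, 1 ≤ j := fun j hj => (mem_Ico.1 (hC hj)).1
    have hmem : ∀ j, 1 ≤ j → j ∈ R → j ∈ C ∧ j ≠ i ∧ j ≠ t := fun j hj h => by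
      rcases mem_insert.1 h with rfl | h
      · omega
      · exact ⟨mem_of_mem_erase (mem_of_mem_erase h), ne_of_mem_erase (mem_of_mem_erase h),
          ne_of_mem_erase h⟩
    have hRcard : C.card = R.card + 1 := by
      have h0 : 0 ∉ (C.erase i).erase t := fun h => by
        have := hpos 0 (mem_of_mem_erase (mem_of_mem_erase h))
        omega
      rw [hR, card_insert_of_notMem h0,
        card_erase_add_one (mem_erase.2 ⟨hit.symm, htC⟩), card_erase_add_one hiC]
    have hRm : R ⊆ range m := by
      refine insert_subset ?_ (((erase_subset _ _).trans (erase_subset _ _)).trans hCm)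
      have := mem_range.1 (hCm i hiC)
      exact mem_range.2 (by omega)
    have hd1 : Disjoint (sub i) (sub t) := by
      refine disjoint_left.2 fun j hj hj' => ?_
      rcases anc_total (mem_filter.1 hj).2 (mem_filter.1 hj').2 with h | h
      · exact hit (hdesc t htC h).symm
      · exact hti h
    have hd2 : Disjoint (sub i ∪ sub t) R := by
      refine disjoint_left.2 fun j hj hjR => ?_
      rcases mem_union.1 hj with hj | hj
      · have hj := (mem_filter.1 hj).2
        obtain ⟨h1, h2, -⟩ := hmem j ((hpos i hiC).trans (hj.le hp)) hjR
        exact h2 (hdesc j h1 hj)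
      · have hj := (mem_filter.1 hj).2
        obtain ⟨h1, -, h2⟩ := hmem j ((hpos t htC).trans (hj.le hp)) hjR
        exact h2 (hdesc' j h1 hj)
    have h1 := sum_le_sum_of_subset (f := w) (union_subset
      (union_subset (filter_subset (Anc p i) (range m)) (filter_subset (Anc p t) (range m))) hRm)
    rw [sum_union hd2, sum_union hd1] at h1
    have h2 := hcard R hRm
    have h3 : x ≤ ∑ j ∈ sub i, w j := (hx i hiC).1
    have h4 : x ≤ ∑ j ∈ sub t, w j := (hx t htC).1
    rw [hRcard, add_mul, one_mul]
    omega

end ParentFun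

/-! ### Counting `k`-sets split by a set of given size -/

/-- The number of `k`-subsets of an `n`-set that meet both parts of a partition of the `n`-set
into parts of sizes `s` and `n - s`, for `1 ≤ k` and `s ≤ n`. -/
def splitCount (n k s : ℕ) : ℝ := n.choose k - s.choose k - (n - s).choose k

/-- The increment `splitCount n k x - splitCount n k (x - 1)` for `1 ≤ x ≤ n`. -/
def splitStep (n k x : ℕ) : ℝ := (n - x).choose (k - 1) - (x - 1).choose (k - 1)

section splitCount

open Finset

variable {n k : ℕ}

theorem splitStep_nonneg {x : ℕ} (hx : x ∈ Icc 1 (n / 2)) : 0 ≤ splitStep n k x := by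
  rw [mem_Icc] at hx
  unfold splitStep
  rw [sub_nonneg, Nat.cast_le]
  exact Nat.choose_le_choose _ (by omega)

theorem sum_splitStep (hk : 1 ≤ k) {s : ℕ} (hs : s ≤ n) :
    ∑ x ∈ Icc 1 s, splitStep n k x = splitCount n k s := by
  obtain ⟨k, rfl⟩ : ∃ l, k = l + 1 := ⟨k - 1, by omega⟩
  induction s with
  | zero => simp [splitCount]
  | succ s ih =>
    rw [sum_Icc_succ_top (by omega), ih (by omega)]
    obtain ⟨d, rfl⟩ : ∃ d, n = s + 1 + d := ⟨n - (s + 1), by omega⟩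
    have h1 : s + 1 + d - s = d + 1 := by omega
    have h2 : s + 1 + d - (s + 1) = d := by omega
    simp only [splitCount, splitStep, h1, h2, Nat.add_sub_cancel, Nat.choose_succ_succ d k,
      Nat.choose_succ_succ s k, Nat.succ_eq_add_one]
    push_cast
    ring

theorem splitCount_symm {s : ℕ} (hs : s ≤ n) : splitCount n k (n - s) = splitCount n k s := by
  unfold splitCount
  rw [Nat.sub_sub_self hs]
  ring

theorem splitCount_eq_sum (hk : 1 ≤ k) {s : ℕ} (hs : s ≤ n) :
    splitCount n k s
      = ∑ x ∈ Icc 1 (n / 2), if x ≤ s ∧ s + x ≤ n then splitStep n k x else 0 := by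
  have hmin : splitCount n k s = splitCount n k (min s (n - s)) := by
    rcases le_total s (n - s) with h | h
    · rw [min_eq_left h]
    · rw [min_eq_right h, splitCount_symm hs]
  rw [hmin, ← sum_splitStep hk (by omega), ← sum_filter]
  refine sum_congr ?_ fun _ _ => rfl
  ext x
  simp only [mem_Icc, mem_filter]
  omega

theorem splitCount_le (s : ℕ) : splitCount n k s ≤ n.choose k := by
  unfold splitCount
  linarith [Nat.cast_nonneg (α := ℝ) (s.choose k), Nat.cast_nonneg (α := ℝ) ((n - s).choose k)]

theorem sum_splitCount (n k : ℕ) :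
    ∑ s ∈ range (n + 1), splitCount n k s
      = ((k : ℝ) - 1) / (k + 1) * (n + 1) * n.choose k := by
  have h1 : ∑ s ∈ range (n + 1), ((s.choose k : ℕ) : ℝ) = (n + 1).choose (k + 1) := by
    rw [← Nat.cast_sum, ← Nat.sum_Icc_choose]
    refine congrArg _ (sum_subset (fun s hs => ?_) fun s hs hs' => Nat.choose_eq_zero_of_lt ?_).symm
    · rw [mem_Icc] at hs
      exact mem_range.2 (by omega)
    · rw [mem_range] at hs
      rw [mem_Icc] at hs'
      omega
  have h2 : ∑ s ∈ range (n + 1), (((n - s).choose k : ℕ) : ℝ) = (n + 1).choose (k + 1) := by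
    rw [← h1, ← sum_range_reflect (fun s => ((s.choose k : ℕ) : ℝ))]
    refine sum_congr rfl fun s _ => ?_
    congr 2
  have h3 : ((n : ℝ) + 1) * n.choose k = (n + 1).choose (k + 1) * (k + 1) := by
    exact_mod_cast Nat.add_one_mul_choose_eq n k
  simp only [splitCount, sum_sub_distrib, h1, h2, sum_const, card_range, nsmul_eq_mul]
  have hk : (k : ℝ) + 1 ≠ 0 := by positivity
  field_simp
  push_cast
  linear_combination (2 : ℝ) * h3

/-- The left-hand side is the sum of `splitCount` over all sizes `s`, because the step at the
threshold `x` contributes for the `n - 2 * x + 1` sizes that leave at least `x` elements in both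
parts. -/
theorem sum_splitStep_mul (hk : 1 ≤ k) :
    ∑ x ∈ Icc 1 (n / 2), splitStep n k x * ((n : ℝ) - 2 * x + 1)
      = ((k : ℝ) - 1) / (k + 1) * (n + 1) * n.choose k := by
  rw [← sum_splitCount, sum_congr rfl fun s hs =>
    splitCount_eq_sum hk (Nat.lt_succ_iff.1 (mem_range.1 hs)), sum_comm]
  refine sum_congr rfl fun x hx => ?_
  rw [← sum_filter, sum_const, nsmul_eq_mul, mul_comm]
  congr 1
  have : (range (n + 1)).filter (fun s => x ≤ s ∧ s + x ≤ n) = Icc x (n - x) := by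
    ext s
    simp only [mem_filter, mem_range, mem_Icc]
    rw [mem_Icc] at hx
    omega
  rw [mem_Icc] at hx
  rw [this, Nat.card_Icc, Nat.cast_sub (by omega)]
  push_cast [Nat.cast_sub (show x ≤ n by omega)]
  ring

/-- If for every `x` at most `(n - 2 * x) / D + 1` of the sizes `s i` leave at least `x` elements
in both parts, then the total `splitCount` is, up to one term of size at most `n.choose k`, at most
a fraction `1 / D` of the sum of `splitCount` over all sizes. -/
theorem sum_splitCount_le (hk : 1 ≤ k) {D : ℕ} (hD : 1 ≤ D) {ι : Type*} (I : Finset ι) (s : ι → ℕ)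
    (hs : ∀ i ∈ I, s i ≤ n)
    (hI : ∀ x, (I.filter fun i => x ≤ s i ∧ s i + x ≤ n).Nonempty →
      2 * x + (I.filter fun i => x ≤ s i ∧ s i + x ≤ n).card * D ≤ n + D) :
    ∑ i ∈ I, splitCount n k (s i)
      ≤ 1 / D * (((k : ℝ) - 1) / (k + 1) * (n + 1) * n.choose k) + (1 - 1 / D) * n.choose k := by
  have hD' : (0 : ℝ) < D := by exact_mod_cast hD
  have hD1 : (1 : ℝ) / D ≤ 1 := by rw [div_le_one hD']; exact_mod_cast hD
  calc ∑ i ∈ I, splitCount n k (s i)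
      = ∑ x ∈ Icc 1 (n / 2),
          splitStep n k x * (I.filter fun i => x ≤ s i ∧ s i + x ≤ n).card := by
        rw [sum_congr rfl fun i hi => splitCount_eq_sum hk (hs i hi), sum_comm]
        refine sum_congr rfl fun x _ => ?_
        rw [← sum_filter, sum_const, nsmul_eq_mul, mul_comm]
    _ ≤ ∑ x ∈ Icc 1 (n / 2), splitStep n k x * (((n : ℝ) - 2 * x) / D + 1) := by
        refine sum_le_sum fun x hx => mul_le_mul_of_nonneg_left ?_ (splitStep_nonneg hx)
        have hx2 : (2 : ℝ) * x ≤ n := by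
          rw [mem_Icc] at hx
          exact_mod_cast (by omega : 2 * x ≤ n)
        rcases (I.filter fun i => x ≤ s i ∧ s i + x ≤ n).eq_empty_or_nonempty with h | h
        · rw [h, card_empty, Nat.cast_zero]
          have := div_nonneg (sub_nonneg.2 hx2) hD'.le
          linarith
        · have h' := hI x h
          rw [← sub_le_iff_le_add, le_div_iff₀ hD']
          have h'' : (2 : ℝ) * x + (I.filter fun i => x ≤ s i ∧ s i + x ≤ n).card * D ≤ n + D := by
            exact_mod_cast h'
          linarith
    _ = 1 / D * ∑ x ∈ Icc 1 (n / 2), splitStep n k x * ((n : ℝ) - 2 * x + 1)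
          + (1 - 1 / D) * ∑ x ∈ Icc 1 (n / 2), splitStep n k x := by
        rw [mul_sum, mul_sum, ← sum_add_distrib]
        refine sum_congr rfl fun x _ => ?_
        field_simp
        ring
    _ ≤ _ := by
        rw [sum_splitStep_mul hk, sum_splitStep hk (Nat.div_le_self n 2)]
        exact add_le_add_right
          (mul_le_mul_of_nonneg_left (splitCount_le _) (sub_nonneg.2 hD1)) _

theorem card_split_powersetCard {V : Type*} [Fintype V] [DecidableEq V] (hk : 1 ≤ k)
    (B : Finset V) :
    ((((univ : Finset V).powersetCard k).filter
      fun S => (∃ v ∈ S, v ∈ B) ∧ ∃ v ∈ S, v ∉ B).card : ℝ)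
      = splitCount (Fintype.card V) k B.card := by
  have hcompl : ((univ : Finset V).powersetCard k).filter
      (fun S => ¬ ((∃ v ∈ S, v ∈ B) ∧ ∃ v ∈ S, v ∉ B))
      = B.powersetCard k ∪ Bᶜ.powersetCard k := by
    ext S
    rw [mem_filter, mem_union, mem_powersetCard_univ, mem_powersetCard, mem_powersetCard, not_and_or]
    simp only [subset_iff, mem_compl]
    push Not
    tauto
  have hdisj : Disjoint (B.powersetCard k) (Bᶜ.powersetCard k) := by
    refine disjoint_left.2 fun S h1 h2 => ?_
    rw [mem_powersetCard] at h1 h2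
    obtain ⟨v, hv⟩ : S.Nonempty := card_pos.1 (by omega)
    exact mem_compl.1 (h2.1 hv) (h1.1 hv)
  have h := card_filter_add_card_filter_not (s := (univ : Finset V).powersetCard k)
    (fun S => (∃ v ∈ S, v ∈ B) ∧ ∃ v ∈ S, v ∉ B)
  rw [hcompl, card_union_of_disjoint hdisj, card_powersetCard, card_powersetCard,
    card_powersetCard, card_univ, card_compl] at h
  unfold splitCount
  rw [← h]
  push_cast
  ring

end splitCount

/-! ### Edges with disjoint neighbourhoods -/

namespace SimpleGraph

/-- The vertices adjacent to one of `u` and `v`. If `u` and `v` are adjacent, these are the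
vertices at distance at most one from the edge `uv`. -/
def edgeNbhd {V : Type*} (G : SimpleGraph V) (u v : V) : Set V := G.neighborSet u ∪ G.neighborSet v

/-- Edges `y i z i` of `G`, for `i < m`, with pairwise disjoint neighbourhoods, and such that
for `0 < i` a path `a i, b i, y i` of `G` leads from the neighbourhood of the edge with index
`p i < i` to the edge with index `i`. The values at indices `m ≤ i`, and those of `a` and `b`
at `0`, are irrelevant; `p` is a parent function on all natural numbers. -/
structure LinkedEdges {V : Type*} (G : SimpleGraph V) (m : ℕ) (y z a b : ℕ → V) (p : ℕ → ℕ) :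
    Prop where
  adj : ∀ i < m, G.Adj (y i) (z i)
  disjoint : ∀ i < m, ∀ j < m, i ≠ j →
    Disjoint (G.edgeNbhd (y i) (z i)) (G.edgeNbhd (y j) (z j))
  parent_zero : p 0 = 0
  parent_lt : ∀ i, 0 < i → p i < i
  mem : ∀ i < m, 0 < i → a i ∈ G.edgeNbhd (y (p i)) (z (p i))
  adj_ab : ∀ i < m, 0 < i → G.Adj (a i) (b i)
  adj_by : ∀ i < m, 0 < i → G.Adj (b i) (y i)

section LinkedEdges

variable {V : Type*} {G : SimpleGraph V} {m : ℕ} {y z a b : ℕ → V} {p : ℕ → ℕ}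

theorem two_mul_le_ncard_edgeNbhd [Fintype V] [DecidableRel G.Adj] (htri : G.CliqueFree 3)
    {u v : V} (huv : G.Adj u v) : 2 * G.minDegree ≤ (G.edgeNbhd u v).ncard := by
  have hdisj : Disjoint (G.neighborSet u) (G.neighborSet v) := by
    classical
    refine Set.disjoint_left.2 fun x hu hv => htri {u, v, x} ?_
    exact is3Clique_triple_iff.2 ⟨huv, hu, hv⟩
  rw [edgeNbhd, Set.ncard_union_eq hdisj]
  have h : ∀ w, G.minDegree ≤ (G.neighborSet w).ncard := fun w => by
    rw [Set.ncard_eq_toFinset_card', Set.toFinset_card, card_neighborSet_eq_degree]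
    exact G.minDegree_le_degree w
  have := h u
  have := h v
  omega

theorem LinkedEdges.unique (h : G.LinkedEdges m y z a b p) {v : V} {i j : ℕ} (hi : i < m)
    (hj : j < m) (hvi : v ∈ G.edgeNbhd (y i) (z i)) (hvj : v ∈ G.edgeNbhd (y j) (z j)) :
    i = j := by
  by_contra hij
  exact Set.disjoint_left.1 (h.disjoint i hi j hj hij) hvi hvj

theorem LinkedEdges.le_card [Fintype V] (h : G.LinkedEdges m y z a b p) : m ≤ Fintype.card V := by
  have hinj : Function.Injective fun i : Fin m => y i := fun i j hij => by
    refine Fin.ext (h.unique (v := y i) i.2 j.2 (Or.inr (h.adj i i.2).symm) ?_)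
    exact Or.inr ((show y i = y j from hij) ▸ (h.adj j j.2).symm)
  simpa using Fintype.card_le_of_injective _ hinj

/-- The vertices covered by the neighbourhoods of the edges. -/
def nbhdUnion (G : SimpleGraph V) (m : ℕ) (y z : ℕ → V) : Set V :=
  {v | ∃ i < m, v ∈ G.edgeNbhd (y i) (z i)}

/-- Linked edges can be extended if some vertex has distance more than two from all their
neighbourhoods. -/
theorem LinkedEdges.exists_succ (h : G.LinkedEdges m y z a b p) (hm : 0 < m) {a' b' u v : V}
    (ha : a' ∈ G.nbhdUnion m y z) (hab : G.Adj a' b') (hbu : G.Adj b' u) (huv : G.Adj u v)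
    (hu : ∀ w ∈ G.nbhdUnion m y z, ¬ G.Adj u w) (hv : ∀ w ∈ G.nbhdUnion m y z, ¬ G.Adj v w) :
    ∃ y z a b p, G.LinkedEdges (m + 1) y z a b p := by
  obtain ⟨q, hq, haq⟩ := ha
  have hd : ∀ i < m, Disjoint (G.edgeNbhd (y i) (z i)) (G.edgeNbhd u v) := fun i hi =>
    Set.disjoint_left.2 fun w hw hw' => hw'.elim (hu w ⟨i, hi, hw⟩) (hv w ⟨i, hi, hw⟩)
  refine ⟨Function.update y m u, Function.update z m v, Function.update a m a',
    Function.update b m b', Function.update p m q, ?_, ?_, ?_, ?_, ?_, ?_, ?_⟩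
  · intro i hi
    rcases Nat.lt_succ_iff_lt_or_eq.1 hi with hi | rfl
    · simpa [hi.ne] using h.adj i hi
    · simpa using huv
  · intro i hi j hj hij
    rcases Nat.lt_succ_iff_lt_or_eq.1 hi with hi | rfl <;>
      rcases Nat.lt_succ_iff_lt_or_eq.1 hj with hj | rfl
    · simpa [hi.ne, hj.ne] using h.disjoint i hi j hj hij
    · simpa [hi.ne] using hd i hi
    · simpa [hj.ne] using (hd j hj).symm
    · exact absurd rfl hij
  · simpa [hm.ne] using h.parent_zero
  · intro i hi
    rcases eq_or_ne i m with rfl | him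
    · simpa using hq
    · simpa [him] using h.parent_lt i hi
  · intro i hi hi0
    rcases Nat.lt_succ_iff_lt_or_eq.1 hi with hi | rfl
    · have := (h.parent_lt i hi0).trans hi
      simpa [hi.ne, this.ne] using h.mem i hi hi0
    · simpa [hq.ne] using haq
  · intro i hi hi0
    rcases Nat.lt_succ_iff_lt_or_eq.1 hi with hi | rfl
    · simpa [hi.ne] using h.adj_ab i hi hi0
    · simpa using hab
  · intro i hi hi0
    rcases Nat.lt_succ_iff_lt_or_eq.1 hi with hi | rfl
    · simpa [hi.ne] using h.adj_by i hi hi0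
    · simpa using hbu

/-- A maximal family of linked edges: every vertex has distance at most two from one of the
neighbourhoods. The distance is recorded by the function `lev`. -/
theorem exists_linkedEdges_lev [Fintype V] (hconn : G.Connected) {u₀ v₀ : V} (h₀ : G.Adj u₀ v₀) :
    ∃ m y z a b p, 0 < m ∧ G.LinkedEdges m y z a b p ∧
      ∃ lev : V → ℕ, ∀ v, lev v ≤ 2 ∧ (lev v = 0 ↔ v ∈ G.nbhdUnion m y z) ∧
        (0 < lev v → ∃ u, G.Adj v u ∧ lev u < lev v) := by
  classical
  obtain ⟨m, hm, ⟨y, z, a, b, p, h⟩, hmax⟩ : ∃ m, 0 < m ∧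
      (∃ y z a b p, G.LinkedEdges m y z a b p) ∧ ¬ ∃ y z a b p, G.LinkedEdges (m + 1) y z a b p := by
    by_contra! hcon
    have hall : ∀ m, ∃ y z a b p, G.LinkedEdges (m + 1) y z a b p := fun m => by
      induction m with
      | zero =>
        refine ⟨fun _ => u₀, fun _ => v₀, fun _ => u₀, fun _ => u₀, fun _ => 0,
          fun _ _ => h₀, ?_, rfl, fun _ h => h, ?_, ?_, ?_⟩ <;> intros <;> omega
      | succ m ih =>
        obtain ⟨y, z, a, b, p, h⟩ := ih
        exact hcon (m + 1) m.succ_pos ⟨y, z, a, b, p, h⟩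
    obtain ⟨y, z, a, b, p, h⟩ := hall (Fintype.card V)
    exact absurd h.le_card (by omega)
  refine ⟨m, y, z, a, b, p, hm, h, ?_⟩
  set U := G.nbhdUnion m y z with hU
  set U₁ : Set V := {v | v ∈ U ∨ ∃ u ∈ U, G.Adj v u} with hU₁
  set U₂ : Set V := {v | v ∈ U₁ ∨ ∃ u ∈ U₁, G.Adj v u} with hU₂
  -- An edge leaving `U₂` would extend the family.
  have hcov : ∀ v, v ∈ U₂ := by
    by_contra! hv
    obtain ⟨w, hw⟩ := hv
    have hy : y 0 ∈ U₂ := Or.inl (Or.inl ⟨0, hm, Or.inr (h.adj 0 hm).symm⟩)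
    obtain ⟨walk⟩ := hconn.preconnected (y 0) w
    obtain ⟨d, -, hd, hd'⟩ := walk.exists_boundary_dart U₂ hy hw
    have hfst : d.fst ∉ U₁ := fun hf => hd' (Or.inr ⟨_, hf, d.adj.symm⟩)
    obtain ⟨b', hb', hdb⟩ := hd.resolve_left hfst
    obtain ⟨a', ha', hba⟩ := hb'.resolve_left fun hf => hfst (Or.inr ⟨b', hf, hdb⟩)
    exact hmax (h.exists_succ hm ha' hba.symm hdb.symm d.adj
      (fun x hx hadj => hfst (Or.inr ⟨x, hx, hadj⟩))
      fun x hx hadj => hd' (Or.inl (Or.inr ⟨x, hx, hadj⟩)))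
  refine ⟨fun v => if v ∈ U then 0 else if v ∈ U₁ then 1 else 2, fun v => ⟨?_, ?_, ?_⟩⟩
  · dsimp only
    split_ifs <;> omega
  · dsimp only
    split_ifs <;> simp_all
  · intro hv
    dsimp only at hv ⊢
    by_cases hvU : v ∈ U
    · simp [hvU] at hv
    by_cases hv1 : v ∈ U₁
    · obtain ⟨u, hu, huv⟩ := hv1.resolve_left hvU
      exact ⟨u, huv, by simp [hvU, hv1, hu]⟩
    · obtain ⟨u, hu, huv⟩ := (hcov v).resolve_left hv1
      refine ⟨u, huv, ?_⟩
      rw [if_neg hvU, if_neg hv1]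
      split_ifs <;> omega

end LinkedEdges

/-! ### The spanning tree -/

/-- The graph of a parent map that decreases a rank is a spanning tree. -/
theorem exists_isTree_of_parent {V : Type*} [Finite V] {G : SimpleGraph V} (r : V) (π : V → V)
    (ρ : V → ℕ) (h : ∀ v, v ≠ r → G.Adj v (π v) ∧ ρ (π v) < ρ v) :
    ∃ T ≤ G, T.IsTree ∧ ∀ v, v ≠ r → T.Adj v (π v) := by
  set E : Set (Sym2 V) := (fun v => s(v, π v)) '' {r}ᶜ with hE
  have hadj : ∀ v, v ≠ r → (fromEdgeSet E).Adj v (π v) := fun v hv =>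
    (fromEdgeSet_adj E).2 ⟨⟨v, hv, rfl⟩, (h v hv).1.ne⟩
  have hconn : (fromEdgeSet E).Connected := by
    have hr : ∀ n v, ρ v = n → (fromEdgeSet E).Reachable v r := fun n => by
      induction n using Nat.strong_induction_on with
      | _ n ih =>
        rintro v rfl
        rcases eq_or_ne v r with rfl | hv
        · exact Reachable.refl _
        · exact (hadj v hv).reachable.trans (ih _ (h v hv).2 _ rfl)
    have : Nonempty V := ⟨r⟩
    exact ⟨fun u v => (hr _ u rfl).trans (hr _ v rfl).symm⟩
  refine ⟨fromEdgeSet E, ?_, ?_, hadj⟩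
  · intro u v huv
    obtain ⟨⟨w, hw, hwe⟩, -⟩ := (fromEdgeSet_adj E).1 huv
    rw [← mem_edgeSet, ← hwe]
    exact (h w hw).1
  · refine isTree_iff_connected_and_card.2 ⟨hconn, le_antisymm ?_ ?_⟩
    · have h1 : (fromEdgeSet E).edgeSet.ncard ≤ E.ncard :=
        Set.ncard_le_ncard (by rw [edgeSet_fromEdgeSet]; exact Set.sdiff_subset)
      have h2 : E.ncard ≤ ({r}ᶜ : Set V).ncard := Set.ncard_image_le
      have h3 := Set.ncard_add_ncard_compl ({r} : Set V)
      rw [Set.ncard_singleton] at h3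
      rw [Nat.card_coe_set_eq]
      omega
    · exact hconn.card_vert_le_card_edgeSet_add_one

/-- A spanning tree that contains the linked edges and the linking paths, joins every vertex of
each neighbourhood to its edge, and descends along `lev` outside the neighbourhoods. -/
theorem LinkedEdges.exists_isTree {V : Type*} [Finite V] {G : SimpleGraph V} {m : ℕ}
    {y z a b : ℕ → V} {p : ℕ → ℕ} (h : G.LinkedEdges m y z a b p) (hm : 0 < m) (lev : V → ℕ)
    (hlev : ∀ v, (lev v = 0 ↔ v ∈ G.nbhdUnion m y z) ∧
      (0 < lev v → ∃ u, G.Adj v u ∧ lev u < lev v)) :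
    ∃ T ≤ G, T.IsTree ∧ (∀ i < m, T.Adj (y i) (z i)) ∧
      (∀ i < m, 0 < i → T.Adj (y i) (b i) ∧ T.Adj (b i) (a i)) ∧
      (∀ i < m, ∀ v ∈ G.edgeNbhd (y i) (z i), ∃ c ∈ ({y i, z i} : Set V), v = c ∨ T.Adj v c) ∧
      ∀ v, ∃ u ∈ G.nbhdUnion m y z, T.SpannedBy {v, u} (lev v) := by
  classical
  have hyN : ∀ i < m, y i ∈ G.edgeNbhd (y i) (z i) := fun i hi => Or.inr (h.adj i hi).symm
  have hzN : ∀ i < m, z i ∈ G.edgeNbhd (y i) (z i) := fun i hi => Or.inl (h.adj i hi)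
  have hbN : ∀ i < m, 0 < i → b i ∈ G.edgeNbhd (y i) (z i) :=
    fun i hi hi0 => Or.inl (h.adj_by i hi hi0).symm
  have hpm : ∀ i < m, 0 < i → p i < m := fun i hi hi0 => (h.parent_lt i hi0).trans hi
  have hby : ∀ i < m, 0 < i → b i ≠ y i := fun i hi hi0 => (h.adj_by i hi hi0).ne
  -- Otherwise `a i` would lie in the neighbourhoods of two edges.
  have hbz : ∀ i < m, 0 < i → b i ≠ z i := fun i hi hi0 hbz =>
    (h.parent_lt i hi0).ne (h.unique (hpm i hi hi0) hi (h.mem i hi hi0)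
      (Or.inr (hbz ▸ (h.adj_ab i hi hi0).symm)))
  obtain ⟨idx, hidx⟩ : ∃ idx : V → ℕ, ∀ v, ∀ i < m, v ∈ G.edgeNbhd (y i) (z i) → idx v = i := by
    have : ∀ v, ∃ j, ∀ i < m, v ∈ G.edgeNbhd (y i) (z i) → j = i := fun v => by
      by_cases hv : ∃ j < m, v ∈ G.edgeNbhd (y j) (z j)
      · obtain ⟨j, hj, hvj⟩ := hv
        exact ⟨j, fun i hi hvi => h.unique hj hi hvj hvi⟩
      · exact ⟨0, fun i hi hvi => absurd ⟨i, hi, hvi⟩ hv⟩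
    choose idx hidx using this
    exact ⟨idx, hidx⟩
  -- In the block of index `i` the order is: the entry vertex `b i`, then `y i`, then `z i`, then
  -- the other vertices. All blocks precede the vertices outside the neighbourhoods.
  set ρ : V → ℕ := fun v => if lev v = 0 then 5 * idx v + (if 0 < idx v ∧ v = b (idx v) then 0
    else if v = y (idx v) then 1 else if v = z (idx v) then 2 else 3) else 5 * m + lev v with hρ
  have hρN : ∀ i < m, ∀ v ∈ G.edgeNbhd (y i) (z i), ρ v = 5 * i + (if 0 < i ∧ v = b i then 0
      else if v = y i then 1 else if v = z i then 2 else 3) := fun i hi v hv => by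
    have h0 : lev v = 0 := (hlev v).1.2 ⟨i, hi, hv⟩
    simp only [hρ, h0, hidx v i hi hv, if_true]
  have hρle : ∀ i < m, ∀ v ∈ G.edgeNbhd (y i) (z i), ρ v ≤ 5 * i + 3 := fun i hi v hv => by
    rw [hρN i hi v hv]
    split_ifs <;> omega
  have hρy : ∀ i < m, ρ (y i) = 5 * i + 1 := fun i hi => by
    rw [hρN i hi _ (hyN i hi), if_neg (fun hc => hby i hi hc.1 hc.2.symm), if_pos rfl]
  have hρz : ∀ i < m, ρ (z i) = 5 * i + 2 := fun i hi => by
    rw [hρN i hi _ (hzN i hi), if_neg (fun hc => hbz i hi hc.1 hc.2.symm),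
      if_neg (h.adj i hi).ne', if_pos rfl]
  have hρb : ∀ i < m, 0 < i → ρ (b i) = 5 * i := fun i hi hi0 => by
    rw [hρN i hi _ (hbN i hi hi0), if_pos ⟨hi0, rfl⟩, add_zero]
  have hroot : ∀ i < m, y i = y 0 → i = 0 := fun i hi hy =>
    h.unique (v := y i) hi hm (hyN i hi) (hy ▸ hyN 0 hm)
  have hparent : ∀ v, v ≠ y 0 → ∃ u, (G.Adj v u ∧ ρ u < ρ v) ∧ (lev v ≠ 0 → lev u < lev v) ∧
      ∀ i < m, v ∈ G.edgeNbhd (y i) (z i) → (v = y i → u = b i) ∧ (v = z i → u = y i) ∧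
        (0 < i → v = b i → u = a i) ∧
        (v ≠ y i → v ≠ z i → ¬ (0 < i ∧ v = b i) → u ∈ ({y i, z i} : Set V)) := by
    intro v hv
    by_cases hlv : lev v = 0
    · obtain ⟨i, hi, hvi⟩ := (hlev v).1.1 hlv
      suffices hs : ∃ u, (G.Adj v u ∧ ρ u < ρ v) ∧ (v = y i → u = b i) ∧ (v = z i → u = y i) ∧
          (0 < i → v = b i → u = a i) ∧
          (v ≠ y i → v ≠ z i → ¬ (0 < i ∧ v = b i) → u ∈ ({y i, z i} : Set V)) by
        obtain ⟨u, hu, hu'⟩ := hs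
        refine ⟨u, hu, fun hc => absurd hlv hc, fun j hj hvj => ?_⟩
        rwa [← h.unique hi hj hvi hvj]
      by_cases hvy : v = y i
      · subst hvy
        have hi0 : 0 < i := Nat.pos_of_ne_zero fun hi0 => hv (hi0 ▸ rfl)
        refine ⟨b i, ⟨(h.adj_by i hi hi0).symm, ?_⟩, fun _ => rfl,
          fun hc => absurd hc (h.adj i hi).ne, fun _ hc => absurd hc.symm (hby i hi hi0),
          fun hc => absurd rfl hc⟩
        rw [hρb i hi hi0, hρy i hi]
        omega
      by_cases hvz : v = z i
      · subst hvz
        refine ⟨y i, ⟨(h.adj i hi).symm, ?_⟩, fun hc => absurd hc hvy, fun _ => rfl,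
          fun hi0 hc => absurd hc.symm (hbz i hi hi0), fun _ hc => absurd rfl hc⟩
        rw [hρy i hi, hρz i hi]
        omega
      by_cases hvb : 0 < i ∧ v = b i
      · obtain ⟨hi0, rfl⟩ := hvb
        refine ⟨a i, ⟨(h.adj_ab i hi hi0).symm, ?_⟩, fun hc => absurd hc hvy,
          fun hc => absurd hc hvz, fun _ _ => rfl, fun _ _ hc => absurd ⟨hi0, rfl⟩ hc⟩
        have h1 := hρle _ (hpm i hi hi0) _ (h.mem i hi hi0)
        have h2 := h.parent_lt i hi0
        rw [hρb i hi hi0]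
        omega
      · have hρv : ρ v = 5 * i + 3 := by
          rw [hρN i hi v hvi, if_neg hvb, if_neg hvy, if_neg hvz]
        rcases hvi with hadj | hadj
        · refine ⟨y i, ⟨hadj.symm, ?_⟩, fun hc => absurd hc hvy, fun hc => absurd hc hvz,
            fun hi0 hc => absurd ⟨hi0, hc⟩ hvb, fun _ _ _ => Or.inl rfl⟩
          rw [hρy i hi, hρv]
          omega
        · refine ⟨z i, ⟨hadj.symm, ?_⟩, fun hc => absurd hc hvy, fun hc => absurd hc hvz,
            fun hi0 hc => absurd ⟨hi0, hc⟩ hvb, fun _ _ _ => Or.inr rfl⟩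
          rw [hρz i hi, hρv]
          omega
    · obtain ⟨u, hvu, hu⟩ := (hlev v).2 (Nat.pos_of_ne_zero hlv)
      refine ⟨u, ⟨hvu, ?_⟩, fun _ => hu, fun i hi hvi => absurd ((hlev v).1.2 ⟨i, hi, hvi⟩) hlv⟩
      have hρv : ρ v = 5 * m + lev v := if_neg hlv
      by_cases hlu : lev u = 0
      · obtain ⟨i, hi, hui⟩ := (hlev u).1.1 hlu
        have := hρle i hi u hui
        omega
      · have hρu : ρ u = 5 * m + lev u := if_neg hlu
        omega
  have : Nonempty V := ⟨y 0⟩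
  choose! π hπ using hparent
  obtain ⟨T, hTG, hT, hadj⟩ := exists_isTree_of_parent (y 0) π ρ fun v hv => (hπ v hv).1
  have hTy : ∀ i < m, 0 < i → T.Adj (y i) (b i) := fun i hi hi0 => by
    have hne : y i ≠ y 0 := fun hc => hi0.ne' (hroot i hi hc)
    have := hadj _ hne
    rwa [((hπ _ hne).2.2 i hi (hyN i hi)).1 rfl] at this
  have hTz : ∀ i < m, T.Adj (y i) (z i) := fun i hi => by
    have hne : z i ≠ y 0 := fun hc => by
      have hi0 := h.unique hi hm (hzN i hi) (hc ▸ hyN 0 hm)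
      subst hi0
      exact (h.adj 0 hm).ne hc.symm
    have := hadj _ hne
    rw [((hπ _ hne).2.2 i hi (hzN i hi)).2.1 rfl] at this
    exact this.symm
  refine ⟨T, hTG, hT, hTz, fun i hi hi0 => ⟨hTy i hi hi0, ?_⟩, fun i hi v hv => ?_, ?_⟩
  · have hne : b i ≠ y 0 := fun hc =>
      hi0.ne' (h.unique hi hm (hbN i hi hi0) (hc ▸ hyN 0 hm))
    have := hadj _ hne
    rwa [((hπ _ hne).2.2 i hi (hbN i hi hi0)).2.2.1 hi0 rfl] at this
  · by_cases hvy : v = y i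
    · exact ⟨y i, Or.inl rfl, Or.inl hvy⟩
    by_cases hvz : v = z i
    · exact ⟨z i, Or.inr rfl, Or.inl hvz⟩
    by_cases hvb : 0 < i ∧ v = b i
    · exact ⟨y i, Or.inl rfl, Or.inr (hvb.2 ▸ (hTy i hi hvb.1).symm)⟩
    · have hne : v ≠ y 0 := fun hc => by
        have hi0 := h.unique hi hm hv (hc ▸ hyN 0 hm)
        subst hi0
        exact hvy hc
      exact ⟨π v, ((hπ v hne).2.2 i hi hv).2.2.2 hvy hvz hvb, Or.inr (hadj v hne)⟩
  · intro v
    induction hn : lev v using Nat.strong_induction_on generalizing v with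
    | _ n ih =>
    subst hn
    by_cases hlv : lev v = 0
    · exact ⟨v, (hlev v).1.1 hlv, (spannedBy_singleton v).mono (by simp) (Nat.zero_le _)⟩
    · have hne : v ≠ y 0 := fun hc => hlv ((hlev v).1.2 ⟨0, hm, hc ▸ hyN 0 hm⟩)
      obtain ⟨u, hu, hs⟩ := ih _ ((hπ v hne).2.1 hlv) (π v) rfl
      refine ⟨u, hu, (hs.insert (v := v) (Set.mem_insert _ _) (Or.inr (hadj v hne))).mono ?_
        ((hπ v hne).2.1 hlv)⟩
      exact Set.insert_subset_insert (Set.subset_insert _ _)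

end SimpleGraph

/-! ### Summation over all `k`-sets -/

open Finset in
/-- Let each index of the tree be the image under `f` of at least `D` vertices. The bound is for
the sum over all `k`-sets `S` of the number of edges of the tree that split `f '' S`; these edges
are collected in `R S`. -/
theorem ParentFun.sum_card_splits_le {V : Type*} [Fintype V] {p : ℕ → ℕ} (hp : ∀ i, p i ≤ i)
    {m D k : ℕ} (hk : 1 ≤ k) (hD : 1 ≤ D) (f : V → ℕ) (hfm : ∀ v, f v < m)
    (hf : ∀ i < m, D ≤ {v | f v = i}.ncard) (R : Finset V → Finset ℕ)
    (hR : ∀ S, ∀ i ∈ R S, i ∈ Ico 1 m ∧ (∃ v ∈ S, Anc p i (f v)) ∧ ∃ v ∈ S, ¬ Anc p i (f v)) :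
    ∑ S ∈ (univ : Finset V).powersetCard k, ((R S).card : ℝ)
      ≤ 1 / D * (((k : ℝ) - 1) / (k + 1) * (Fintype.card V + 1) * (Fintype.card V).choose k)
        + (1 - 1 / D) * (Fintype.card V).choose k := by
  classical
  set w : ℕ → ℕ := fun i => (univ.filter fun v => f v = i).card with hw
  have hwD : ∀ i < m, D ≤ w i := fun i hi => by
    have := hf i hi
    rwa [Set.ncard_eq_toFinset_card', Set.toFinset_ofFinset] at this
  have hfib : ∀ P : ℕ → Prop, ∑ i ∈ (range m).filter P, w i
      = (univ.filter fun v => P (f v)).card := fun P => by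
    rw [card_eq_sum_card_fiberwise (f := f) (t := (range m).filter P)]
    · refine sum_congr rfl fun i hi => ?_
      rw [filter_filter]
      refine congrArg card (filter_congr fun v _ => ?_)
      constructor
      · rintro rfl
        exact ⟨(mem_filter.1 hi).2, rfl⟩
      · exact fun h => h.2
    · intro v hv
      simp only [coe_filter, mem_univ, true_and, Set.mem_ofPred_eq] at hv
      simpa using ⟨hfm v, hv⟩
  have htot : ∑ i ∈ range m, w i = Fintype.card V := by
    have := hfib fun _ => True
    simpa using this
  set B : ℕ → Finset V := fun i => univ.filter fun v => Anc p i (f v) with hB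
  have hsub : ∀ i, subtreeWeight p m w i = (B i).card := fun i => by
    rw [subtreeWeight, hfib]
  calc ∑ S ∈ (univ : Finset V).powersetCard k, ((R S).card : ℝ)
      ≤ ∑ S ∈ (univ : Finset V).powersetCard k, ∑ i ∈ Ico 1 m,
          if (∃ v ∈ S, v ∈ B i) ∧ ∃ v ∈ S, v ∉ B i then (1 : ℝ) else 0 := by
        refine sum_le_sum fun S _ => ?_
        rw [sum_boole, Nat.cast_le]
        refine card_le_card fun i hi => ?_
        obtain ⟨h1, h2⟩ := hR S i hi
        exact mem_filter.2 ⟨h1, by simpa [hB] using h2⟩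
    _ = ∑ i ∈ Ico 1 m, splitCount (Fintype.card V) k (B i).card := by
        rw [sum_comm]
        refine sum_congr rfl fun i _ => ?_
        rw [sum_boole, card_split_powersetCard hk]
    _ ≤ _ := by
        refine sum_splitCount_le hk hD _ _ (fun i _ => card_le_univ _) fun x hne => ?_
        rw [← htot] at hne ⊢
        refine two_mul_add_card_mul_le hp hwD (filter_subset _ _) hne fun i hi => ?_
        rw [hsub]
        exact (mem_filter.1 hi).2

theorem theorem4 {V : Type*} [Fintype V] (G : SimpleGraph V) [DecidableRel G.Adj]
    (hconn : G.Connected) (htri : G.CliqueFree 3)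
    (n δ k : ℕ) (hn : Fintype.card V = n) (hδ : G.minDegree = δ) (hδ1 : 1 ≤ δ) (hk : 1 ≤ k) :
    ∃ T : SimpleGraph V, T.IsSpanningTree G ∧
      (T.steinerWiener k : ℝ) ≤
        ((k : ℝ) - 1) / ((k : ℝ) + 1) * (2 * ((n : ℝ) + 1) / (δ : ℝ)) * (n.choose k : ℝ)
          + ((4 * (δ : ℝ) - 2) / (δ : ℝ) + 3 * (k : ℝ) + 1) * (n.choose k : ℝ) := by
  classical
  subst hn
  obtain ⟨u₀⟩ := hconn.nonempty
  obtain ⟨v₀, h₀⟩ : ∃ v₀, G.Adj u₀ v₀ := by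
    rw [← G.degree_pos_iff_exists_adj]
    have := G.minDegree_le_degree u₀
    omega
  obtain ⟨m, y, z, a, b, p, hm, h, lev, hlev⟩ := SimpleGraph.exists_linkedEdges_lev hconn h₀
  obtain ⟨T, hTG, hT, hyz, hyba, hnbhd, hcov⟩ := h.exists_isTree hm lev fun v => (hlev v).2
  refine ⟨T, ⟨hTG, hT⟩, ?_⟩
  have hp : ∀ i, p i ≤ i := fun i => by
    rcases Nat.eq_zero_or_pos i with rfl | hi
    · exact h.parent_zero.le
    · exact (h.parent_lt i hi).le
  -- Each vertex is assigned to an edge at distance at most three in `T`.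
  have hassign : ∀ v, ∃ i < m, (∃ c ∈ ({y i, z i} : Set V), T.SpannedBy {v, c} 3) ∧
      ∀ j < m, v ∈ G.edgeNbhd (y j) (z j) → i = j := fun v => by
    obtain ⟨u, ⟨i, hi, hui⟩, hvu, huv⟩ : ∃ u ∈ G.nbhdUnion m y z, T.SpannedBy {v, u} 2 ∧
        (v ∈ G.nbhdUnion m y z → u = v) := by
      by_cases hv : v ∈ G.nbhdUnion m y z
      · exact ⟨v, hv, (SimpleGraph.spannedBy_singleton v).mono (by simp) (Nat.zero_le _),
          fun _ => rfl⟩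
      · obtain ⟨u, hu, hvu⟩ := hcov v
        exact ⟨u, hu, hvu.mono subset_rfl (hlev v).1, fun hv' => absurd hv' hv⟩
    obtain ⟨c, hc, huc⟩ := hnbhd i hi u hui
    have hcu : c = u ∨ T.Adj c u := huc.imp Eq.symm SimpleGraph.Adj.symm
    refine ⟨i, hi, ⟨c, hc, (hvu.insert (Or.inr rfl) hcu).mono
      (by rintro x (rfl | rfl) <;> simp) le_rfl⟩, fun j hj hvj => ?_⟩
    exact h.unique hi hj hui (huv ⟨j, hj, hvj⟩ ▸ hvj)
  choose f hfm hfc hfN using hassign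
  have hfcard : ∀ i < m, 2 * G.minDegree ≤ {v | f v = i}.ncard := fun i hi =>
    (SimpleGraph.two_mul_le_ncard_edgeNbhd htri (h.adj i hi)).trans
      (Set.ncard_le_ncard fun v hv => hfN v i hi hv)
  set R : Finset V → Finset ℕ := fun S =>
    (Finset.Ico 1 m).filter fun i => ParentFun.Splits p i (S.image f) with hR
  have hdist : ∀ S ∈ (Finset.univ : Finset V).powersetCard k,
      T.steinerDist (S : Set V) ≤ 3 * k + (4 * (R S).card + 1) := fun S hS => by
    have hSk : S.card = k := (Finset.mem_powersetCard.1 hS).2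
    have hSne : S.Nonempty := Finset.card_pos.1 (by omega)
    have hblocks := ParentFun.spannedBy_biUnion (T := T) (m := m) h.parent_zero h.parent_lt
      (fun i => {y i, z i}) (fun i hi => (hyz i hi).spannedBy) (fun i hi hi0 => by
        obtain ⟨c, hc, hac⟩ := hnbhd _ ((h.parent_lt i hi0).trans hi) _ (h.mem i hi hi0)
        have hca : c = a i ∨ T.Adj c (a i) := hac.imp Eq.symm SimpleGraph.Adj.symm
        obtain ⟨hyb, hba⟩ := hyba i hi hi0
        refine ⟨c, hc, ((((hyz i hi).spannedBy.insert (Set.mem_insert _ _)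
          (Or.inr hyb.symm)).insert (Set.mem_insert _ _) (Or.inr hba.symm)).insert
          (Set.mem_insert _ _) hca).mono ?_ le_rfl⟩
        exact Set.insert_subset_insert
          ((Set.subset_insert _ _).trans (Set.subset_insert _ _)))
      (S.image f) (hSne.image f) (by simpa using fun v _ => hfm v) (R S)
      (fun i hi hs => Finset.mem_filter.2 ⟨hi, hs⟩)
    rw [← hSk]
    refine (hblocks.of_forall_exists S fun v hv => ?_).steinerDist_le
    obtain ⟨c, hc, hvc⟩ := hfc v
    exact ⟨c, Set.mem_biUnion (Finset.mem_image_of_mem f hv) hc, hvc⟩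
  have hsum := ParentFun.sum_card_splits_le hp hk (D := 2 * G.minDegree) (by omega) f hfm hfcard R
    fun S i hi => by
      obtain ⟨h1, h2⟩ := Finset.mem_filter.1 hi
      exact ⟨h1, by simpa [ParentFun.Splits] using h2⟩
  have hle : (T.steinerWiener k : ℝ) ≤
      (3 * k + 1) * (Fintype.card V).choose k
        + 4 * ∑ S ∈ (Finset.univ : Finset V).powersetCard k, ((R S).card : ℝ) := by
    have := Finset.sum_le_sum hdist
    simp only [Finset.sum_add_distrib, Finset.sum_const, Finset.card_powersetCard,
      Finset.card_univ, smul_eq_mul, ← Finset.mul_sum] at this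
    have hcast : (T.steinerWiener k : ℝ) ≤ _ := Nat.cast_le.2 this
    push_cast at hcast
    linarith
  have hδ0 : (0 : ℝ) < δ := by exact_mod_cast hδ1
  rw [hδ] at hsum
  refine hle.trans ((add_le_add_right (mul_le_mul_of_nonneg_left hsum (by norm_num)) _).trans_eq ?_)
  push_cast
  field_simp
  ring
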